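/- Let $n$ be a natural number and $V$ a real vector space of dimension $2n$. Equip $V\oplus V^*$ with $\langle v+\eta,w+\theta\rangle=\tfrac12\eta(w)+\tfrac12\theta(v)$, and let the real Clifford algebra $\mathrm{CL}(V\oplus V^*)$ (with $E\cdot E=\langle E,E\rangle$) act on $\wedge^*V^*\otimes\mathbb C$ by $(v+\eta)\cdot\phi=i_v\phi+\eta\wedge\phi$. Let $\mathrm{Cpin}(V\oplus V^*)$ be the group of invertible $g\in\mathrm{CL}(V\oplus V^*)$ with $\tilde g^{-1}(V\oplus V^*)g\subset V\oplus V^*$, where $\tilde g$ is the parity involution. Let $\mathrm{CL}^k$ be the span of the products of $m$ elements of $V\oplus V^*$, $m\le k$, $m\equiv k \bmod 2$. An $\mathrm{SL}_n(\mathbb C)$ structure on $V$ is a non-zero complex $n$-form that is of type $(n,0)$ for some complex structure on $V$, and $\mathcal B_{\mathrm{SL}}(V)$, the set of generalized $\mathrm{SL}_n(\mathbb C)$ structures, is the orbit of the $\mathrm{SL}_n(\mathbb C)$ structures under $\mathrm{Cpin}(V\oplus V^*)$. For a smooth Hausdorff manifold $X$ of dimension $2n$, a $\mathcal B_{\mathrm{SL}}$-structure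 on $X$ is a smooth $d$-closed complex differential form $\phi$ (of mixed degree) with $\phi_x\in\mathcal B_{\mathrm{SL}}(T_xX)$ for all $x$. Its deformation complex $\#_{\mathcal B_{\mathrm{SL}}}$ is $$0\to \mathbf E^{-1}\xrightarrow{d}\mathbf E^{0}\xrightarrow{d}\mathbf E^{1}\xrightarrow{d}\mathbf E^{2}\to\cdots,\qquad \mathbf E^{k}=\mathrm{CL}^{k+1}(T\oplus T^*)\cdot\phi ,$$ with $d$ the exterior derivative; here $\mathbf E^{-1}=\mathbb R\phi$ is a real line bundle. Let $\tilde\#_{\mathcal B_{\mathrm{SL}}}$ be the complex obtained by replacing $\mathbf E^{-1}$ by $\mathbf E^{-1}\otimes\mathbb C=\mathbb C\phi$. Such a complex is called elliptic at degree $k$ if, for every $x\in X$ and every non-zero real covector $\xi\in T_x^*X$, its principal symbol sequence at $\xi$ is exact at the term of degree $k$, and an orbit is called elliptic if, at each of its points, the symbol sequence (given by $\xi\wedge\cdot$) is exact at the degrees $k=1,2$ for all $\xi\ne0$. Then, for every $\mathcal B_{\mathrm{SL}}$-structure $\phi$ on $X$, the complex $\#_{\mathcal B_{\mathrm{SL}}}$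 is elliptic at every degree $k\neq 0$ (in particular at $k=1,2$), and the complex $\tilde\#_{\mathcal B_{\mathrm{SL}}}$ is elliptic at every degree. Moreover, $\mathcal B_{\mathrm{SL}}(V)$ is an elliptic orbit. -/

import Mathlib

open scoped Manifold ContDiff

noncomputable section

namespace GenSL

section Linear

variable (V : Type*) [NormedAddCommGroup V] [NormedSpace ℝ V]

/-- The dual space `V^*`. -/
abbrev Cov : Type _ := V →L[ℝ] ℝ

/-- The spin representation space `⋀^* V^* ⊗ ℂ` of complex forms of mixed degree: `φ p` is the
component of degree `p` (for finite-dimensional `V` only finitely many degrees are non-zero).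
As a real representation it is a pair of copies of `⋀^* V^*`. -/
abbrev Spinor : Type _ := (p : ℕ) → V [⋀^Fin p]→L[ℝ] ℂ

/-- The bilinear form `⟨v + η, w + θ⟩ = η(w)/2 + θ(v)/2` on `V ⊕ V^*`. -/
def pairing : LinearMap.BilinForm ℝ (V × Cov V) :=
  LinearMap.mk₂ ℝ (fun E F => (1 / 2 : ℝ) * E.2 F.1 + (1 / 2 : ℝ) * F.2 E.1)
    (by intros; simp; ring) (by intros; simp; ring)
    (by intros; simp; ring) (by intros; simp; ring)

/-- The quadratic form `‖E‖² = ⟨E, E⟩` on `V ⊕ V^*`. -/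
def quad : QuadraticForm ℝ (V × Cov V) := (pairing V).toQuadraticMap

theorem quad_apply (E : V × Cov V) : quad V E = E.2 E.1 := by
  simp only [quad, pairing, LinearMap.BilinMap.toQuadraticMap_apply, LinearMap.mk₂_apply]
  ring

/-- The real Clifford algebra `CL(V ⊕ V^*)`, with `E · E = ‖E‖²`. -/
abbrev CL : Type _ := CliffordAlgebra (quad V)

variable {V}

/-- Exterior product `η ∧ α` of a covector with a form of degree `p`. -/
def wedgeForm {p : ℕ} (η : Cov V) (α : V [⋀^Fin p]→L[ℝ] ℂ) : V [⋀^Fin (p + 1)]→L[ℝ] ℂ :=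
  ContinuousAlternatingMap.alternatizeUncurryFin (η.smulRight α)

theorem wedgeForm_apply {p : ℕ} (η : Cov V) (α : V [⋀^Fin p]→L[ℝ] ℂ) (u : Fin (p + 1) → V) :
    wedgeForm η α u = ∑ i : Fin (p + 1), (-1 : ℤ) ^ (i : ℕ) • (η (u i) • α (i.removeNth u)) := by
  simp [wedgeForm, ContinuousAlternatingMap.alternatizeUncurryFin_apply]

/-- Exterior product with a covector on forms of mixed degree. -/
def wedge (η : Cov V) : Spinor V →ₗ[ℝ] Spinor V where
  toFun φ p := match p with
    | 0 => 0
    | q + 1 => wedgeForm η (φ q)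
  map_add' φ ψ := by
    funext p
    cases p with
    | zero => simp
    | succ q =>
      ext u
      simp [wedgeForm_apply, Finset.sum_add_distrib]
  map_smul' c φ := by
    funext p
    cases p with
    | zero => exact (smul_zero (A := V [⋀^Fin 0]→L[ℝ] ℂ) c).symm
    | succ q =>
      ext u
      simp only [wedgeForm_apply, Pi.smul_apply, ContinuousAlternatingMap.smul_apply,
        RingHom.id_apply, Finset.smul_sum]
      refine Finset.sum_congr rfl fun i _ => ?_
      rw [smul_comm (η (u i)) c, smul_comm ((-1 : ℤ) ^ (i : ℕ)) c]

/-- Interior product with a vector on forms of mixed degree. -/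
def interior (v : V) : Spinor V →ₗ[ℝ] Spinor V where
  toFun φ p := (φ (p + 1)).curryLeft v
  map_add' φ ψ := by funext p; simp
  map_smul' c φ := by funext p; simp

@[simp] theorem wedge_zero (η : Cov V) (φ : Spinor V) : wedge η φ 0 = 0 := rfl

@[simp] theorem wedge_succ (η : Cov V) (φ : Spinor V) (p : ℕ) :
    wedge η φ (p + 1) = wedgeForm η (φ p) := rfl

@[simp] theorem interior_apply (v : V) (φ : Spinor V) (p : ℕ) :
    interior v φ p = (φ (p + 1)).curryLeft v := rfl

variable (V) in
/-- The action `E · φ = i_v φ + η ∧ φ` of `E = v + η`. -/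
def vecAction : V × Cov V →ₗ[ℝ] Module.End ℝ (Spinor V) where
  toFun E := interior E.1 + wedge E.2
  map_add' E F := by
    refine LinearMap.ext fun φ => funext fun p => ?_
    cases p with
    | zero => simp
    | succ q =>
      ext u
      simp [wedgeForm_apply, add_smul, Finset.sum_add_distrib]
      abel
  map_smul' c E := by
    refine LinearMap.ext fun φ => funext fun p => ?_
    cases p with
    | zero => simp
    | succ q =>
      ext u
      simp [wedgeForm_apply, mul_smul, Finset.mul_sum, mul_left_comm]

theorem vecAction_apply (E : V × Cov V) (φ : Spinor V) :
    vecAction V E φ = interior E.1 φ + wedge E.2 φ := rfl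

theorem curryLeft_wedgeForm_zero (η : Cov V) (v : V) (α : V [⋀^Fin 0]→L[ℝ] ℂ) :
    (wedgeForm η α).curryLeft v = η v • α := by
  ext u
  simp [wedgeForm_apply]

theorem curryLeft_wedgeForm_succ {p : ℕ} (η : Cov V) (v : V) (α : V [⋀^Fin (p + 1)]→L[ℝ] ℂ) :
    (wedgeForm η α).curryLeft v + wedgeForm η (α.curryLeft v) = η v • α := by
  ext u
  simp only [ContinuousAlternatingMap.add_apply, ContinuousAlternatingMap.curryLeft_apply_apply,
    ContinuousAlternatingMap.smul_apply]
  rw [wedgeForm_apply, wedgeForm_apply, Fin.sum_univ_succ]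
  have h : ∀ j : Fin (p + 1),
      (j.succ.removeNth (Matrix.vecCons v u) : Fin (p + 1) → V) =
        Matrix.vecCons v (j.removeNth u) := by
    intro j
    funext k
    refine Fin.cases ?_ (fun k => ?_) k
    · simp [Fin.removeNth]
    · simp [Fin.removeNth]
  have h0 : (Fin.removeNth 0 (Matrix.vecCons v u) : Fin (p + 1) → V) = u := by
    funext k
    simp [Fin.removeNth]
  simp [h, h0, pow_succ, Finset.sum_neg_distrib]

theorem wedgeForm_wedgeForm {p : ℕ} (η : Cov V) (α : V [⋀^Fin p]→L[ℝ] ℂ) :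
    wedgeForm η (wedgeForm η α) = 0 := by
  have := ContinuousAlternatingMap.alternatizeUncurryFin_alternatizeUncurryFinCLM_comp_of_symmetric
    (f := η.smulRight (η.smulRight α)) (fun x y => by simp [smul_smul, mul_comm])
  rw [← this]
  unfold wedgeForm
  congr 1
  ext x u
  simp

theorem vecAction_sq (E : V × Cov V) :
    vecAction V E * vecAction V E = algebraMap ℝ _ (quad V E) := by
  refine LinearMap.ext fun φ => funext fun p => ?_
  rw [quad_apply, Module.algebraMap_end_apply, Module.End.mul_apply, vecAction_apply,
    vecAction_apply]
  match p with
  | 0 => simp [curryLeft_wedgeForm_zero]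
  | 1 =>
    have h := curryLeft_wedgeForm_succ E.2 E.1 (φ 1)
    simp only [Pi.add_apply, interior_apply, wedge_succ, wedge_zero, Pi.smul_apply,
      ContinuousAlternatingMap.curryLeft_add, add_apply,
      ContinuousAlternatingMap.curryLeft_same, add_zero, zero_add]
    exact h
  | q + 2 =>
    have h := curryLeft_wedgeForm_succ E.2 E.1 (φ (q + 2))
    have h2 : ∀ a b : V [⋀^Fin (q + 1)]→L[ℝ] ℂ,
        wedgeForm E.2 (a + b) = wedgeForm E.2 a + wedgeForm E.2 b := by
      intro a b; ext u; simp [wedgeForm_apply, Finset.sum_add_distrib]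
    simp only [Pi.add_apply, interior_apply, wedge_succ, Pi.smul_apply,
      ContinuousAlternatingMap.curryLeft_add, add_apply, h2,
      ContinuousAlternatingMap.curryLeft_same, add_zero, zero_add, wedgeForm_wedgeForm]
    exact h

variable (V) in
/-- The spin representation of the Clifford algebra on complex forms. -/
def spin : CL V →ₐ[ℝ] Module.End ℝ (Spinor V) :=
  CliffordAlgebra.lift (quad V) ⟨vecAction V, vecAction_sq⟩

variable (V) in
/-- The conformal pin group: the invertible `g` in the Clifford algebra such that
`g̃⁻¹ · E · g` lies in `V ⊕ V^*` for all `E` in `V ⊕ V^*`, with `g̃` the parity involution of `g`. -/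
def Cpin : Set (CL V)ˣ :=
  {g | ∀ E : V × Cov V,
    CliffordAlgebra.involute ((g⁻¹ : (CL V)ˣ) : CL V) * CliffordAlgebra.ι (quad V) E * (g : CL V)
      ∈ LinearMap.range (CliffordAlgebra.ι (quad V))}

variable (V) in
/-- The filtration `CL^k`: the span of the products of `m` elements of `V ⊕ V^*`, for `m ≤ k` with
`m ≡ k` modulo 2 (so that `CL^k = 0` for `k < 0`). -/
def CLfil (k : ℤ) : Submodule ℝ (CL V) :=
  ⨆ (m : ℕ) (_ : (m : ℤ) ≤ k ∧ Even (k - m)), LinearMap.range (CliffordAlgebra.ι (quad V)) ^ m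

/-- The fibre `E^k = CL^{k+1} · Φ` of the deformation complex. -/
def defFibre (Φ : Spinor V) (k : ℤ) : Submodule ℝ (Spinor V) :=
  (CLfil V (k + 1)).map ((spin V).toLinearMap.flip Φ)

/-- The fibre of the complex in which the real line `E^{-1} = ℝ Φ` is replaced by its
complexification `ℂ Φ`, the other terms being unchanged. -/
def defFibreC (Φ : Spinor V) (k : ℤ) : Submodule ℝ (Spinor V) :=
  if k = -1 then (Submodule.span ℂ {Φ}).restrictScalars ℝ else defFibre Φ k

/-- Exactness at the degree `k` of a sequence of subspaces `F^k` with the maps induced by `σ`: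
`σ(F^{k-1})` equals the kernel of `σ` on `F^k`. -/
def ExactAt {M : Type*} [AddCommGroup M] [Module ℝ M] (F : ℤ → Submodule ℝ M)
    (σ : M →ₗ[ℝ] M) (k : ℤ) : Prop :=
  (F (k - 1)).map σ = F k ⊓ LinearMap.ker σ

/-- An orbit `B` is elliptic if, at each of its points `Φ`, the symbol sequence of the deformation
complex, `ξ ∧ · : E^{k-1} → E^k → E^{k+1}`, is exact at the degrees `k = 1, 2` for all
covectors `ξ ≠ 0`. -/
def IsEllipticOrbit (B : Set (Spinor V)) : Prop :=
  ∀ Φ ∈ B, ∀ ξ : Cov V, ξ ≠ 0 → ∀ k : ℤ, (k = 1 ∨ k = 2) → ExactAt (defFibre Φ) (wedge ξ) k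

variable (V) in
/-- `SL_n(ℂ)` structures: the non-zero complex `n`-forms on `V` that are of type `(n,0)` for some
complex structure `J` on `V`, i.e. that are `J`-complex linear in each argument. -/
def ASL (n : ℕ) : Set (Spinor V) :=
  {Ω | ∃ (J : V →ₗ[ℝ] V) (α : V [⋀^Fin n]→L[ℝ] ℂ),
    (∀ v, J (J v) = -v) ∧ α ≠ 0 ∧
    (∀ (u : Fin n → V) (i : Fin n), α (Function.update u i (J (u i))) = Complex.I * α u) ∧
    Ω = Pi.single n α}

variable (V) in
/-- Generalized `SL_n(ℂ)` structures on `V`: the orbit of the `SL_n(ℂ)` structures under the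
conformal pin group. -/
def BSL (n : ℕ) : Set (Spinor V) :=
  {Φ | ∃ Ω ∈ ASL V n, ∃ g ∈ Cpin V, Φ = spin V (g : CL V) Ω}

end Linear

section Manifold

variable {V : Type*} [NormedAddCommGroup V] [NormedSpace ℝ V]
variable {X : Type*} [TopologicalSpace X] [ChartedSpace V X]

/-- The pull-back to the model space `V` of the degree `p` part of a form `α` on `X` along the
inverse of the preferred chart at `x₀`. A form on `X` is a function `X → Spinor V`, as the tangent
space of `X` at each point is, by definition, a copy of the model space `V`. -/
def inChart (α : X → Spinor V) (x₀ : X) (p : ℕ) (y : V) : V [⋀^Fin p]→L[ℝ] ℂ :=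
  (α ((extChartAt 𝓘(ℝ, V) x₀).symm y) p).compContinuousLinearMap
    (mfderiv 𝓘(ℝ, V) 𝓘(ℝ, V) (extChartAt 𝓘(ℝ, V) x₀).symm y : V →L[ℝ] V)

/-- Smooth (complex, mixed degree) differential forms on `X`. -/
def SmoothForm (α : X → Spinor V) : Prop :=
  ∀ (x₀ : X) (p : ℕ), ContDiffOn ℝ ∞ (inChart α x₀ p) (extChartAt 𝓘(ℝ, V) x₀).target

/-- The exterior derivative of a form on `X`, computed at `x` in the preferred chart at `x`. -/
def dForm (α : X → Spinor V) (x : X) : Spinor V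
  | 0 => 0
  | p + 1 => (extDeriv (inChart α x p) (extChartAt 𝓘(ℝ, V) x x)).compContinuousLinearMap
      (mfderiv 𝓘(ℝ, V) 𝓘(ℝ, V) (extChartAt 𝓘(ℝ, V) x) x : V →L[ℝ] V)

/-- `σ` is the principal symbol at the covector `ξ` at `x` of the first order differential
operator `D` on forms: `D (f α) (x) = σ (α x)` for all smooth forms `α` and all smooth functions `f`
with `f(x) = 0` and `df_x = ξ`. -/
def IsPrincipalSymbol (D : (X → Spinor V) → X → Spinor V) (x : X) (ξ : Cov V)
    (σ : Spinor V →ₗ[ℝ] Spinor V) : Prop :=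
  ∀ (f : X → ℝ) (α : X → Spinor V), ContMDiff 𝓘(ℝ, V) 𝓘(ℝ, ℝ) ∞ f → SmoothForm α →
    f x = 0 → (mfderiv 𝓘(ℝ, V) 𝓘(ℝ, ℝ) f x : V →L[ℝ] ℝ) = ξ →
    D (fun y => f y • α y) x = σ (α x)

/-- Ellipticity at the degree `k` of a complex whose term of degree `k` is the bundle with fibres
`F x k` and whose operators are the restrictions of `D`: for all `x` and all covectors `ξ ≠ 0` at
`x`, the principal symbol sequence is exact at the degree `k`. -/
def IsEllipticAt (F : X → ℤ → Submodule ℝ (Spinor V)) (D : (X → Spinor V) → X → Spinor V)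
    (k : ℤ) : Prop :=
  ∀ (x : X) (ξ : Cov V), ξ ≠ 0 →
    ∃ σ : Spinor V →ₗ[ℝ] Spinor V, IsPrincipalSymbol D x ξ σ ∧ ExactAt (F x) σ k

/-- A structure on `X` associated with an orbit `B`: a smooth `d`-closed form `ϕ` on `X` with
values in the orbit. -/
structure IsStructure (B : Set (Spinor V)) (ϕ : X → Spinor V) : Prop where
  smooth : SmoothForm ϕ
  mem_orbit : ∀ x, ϕ x ∈ B
  closed : ∀ x, dForm ϕ x = 0

end Manifold

end GenSL

end

noncomputable section

namespace GenSL

/-! ### Clifford relations and complex linearity of the spin representation -/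

section Linear

variable {V : Type*} [NormedAddCommGroup V] [NormedSpace ℝ V]

/-! The argument is a contracting homotopy built from annihilators of `Φ`. An `(n,0)`-form `Ω`
satisfies `i E · Ω = F · Ω` for a suitable real `F` depending on `E`: contraction turns `i` into
`J`, and wedging `Ω` with a `(1,0)`-covector gives zero. Conjugation by the conformal pin group
preserves this property (`IsComplexOrbitPoint`), so it holds on the whole orbit.

Thus every `E` yields a complex vector `u = F - iE` annihilating `Φ`. Anticommuting `u` through a
product of vectors leaves only scalars, so `u` maps the complexified `E^k` into the complexified
`E^{k-1}`. For `ξ ≠ 0` take `E = v` with `ξ(v) ≠ 0`: then `u ξ + ξ u` is a scalar with non-zero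
imaginary part, and `u` divided by that scalar is a contracting homotopy for `ξ ∧ ·`. Hence the
complexified symbol sequence is exact in every degree (`exactAt_complexFibre`).

For `k ≥ 0` the real fibres are already complex subspaces (`complexFibre_eq_defFibre`), so
complexifying alters only `E^{-1}`, which costs exactness at most at degree `0`. On a manifold the
symbol of `d` is `ξ ∧ ·`. -/

/-- The Clifford action is complex linear. -/
theorem vecAction_smul_complex (E : V × Cov V) (c : ℂ) (φ : Spinor V) :
    vecAction V E (c • φ) = c • vecAction V E φ := by
  funext p
  cases p with
  | zero => ext u; simp [vecAction_apply]
  | succ q =>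
    ext u
    simp only [vecAction_apply, Pi.add_apply, Pi.smul_apply, interior_apply, wedge_succ,
      ContinuousAlternatingMap.add_apply, ContinuousAlternatingMap.smul_apply,
      ContinuousAlternatingMap.curryLeft_apply_apply, wedgeForm_apply, smul_add, Finset.smul_sum]
    congr 1
    refine Finset.sum_congr rfl fun i _ => ?_
    rw [smul_comm (E.2 (u i)) c, smul_comm ((-1 : ℤ) ^ (i : ℕ)) c]

theorem quad_polar (E F : V × Cov V) :
    quad V (E + F) - quad V E - quad V F = 2 * pairing V E F := by
  simp only [quad_apply, pairing, LinearMap.mk₂_apply, Prod.fst_add, Prod.snd_add,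
    _root_.add_apply, map_add]
  ring

theorem vecAction_vecAction (E : V × Cov V) (φ : Spinor V) :
    vecAction V E (vecAction V E φ) = quad V E • φ := by
  have := LinearMap.congr_fun (vecAction_sq E) φ
  simpa [Module.algebraMap_end_apply] using this

theorem vecAction_anticomm (E F : V × Cov V) (φ : Spinor V) :
    vecAction V E (vecAction V F φ) + vecAction V F (vecAction V E φ) =
      (2 * pairing V E F) • φ := by
  have h := vecAction_vecAction (E + F) φ
  simp only [map_add, LinearMap.add_apply, vecAction_vecAction] at h
  rw [← quad_polar, sub_smul (M := Spinor V), sub_smul (M := Spinor V), ← h]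
  abel

theorem wedge_eq_vecAction (ξ : Cov V) : wedge ξ = vecAction V (0, ξ) := by
  refine LinearMap.ext fun φ => funext fun p => ?_
  cases p with
  | zero => ext u; simp [vecAction_apply]
  | succ q => ext u; simp [vecAction_apply]

@[simp] theorem spin_ι (E : V × Cov V) :
    spin V (CliffordAlgebra.ι (quad V) E) = vecAction V E := by
  simp [spin]

theorem spin_smul_complex (a : CL V) (c : ℂ) (φ : Spinor V) :
    spin V a (c • φ) = c • spin V a φ := by
  induction a using CliffordAlgebra.induction generalizing φ with
  | algebraMap r => simp only [AlgHom.commutes, Module.algebraMap_end_apply]; exact smul_comm _ _ _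
  | ι E => simp [vecAction_smul_complex]
  | mul a b ha hb => simp [ha, hb]
  | add a b ha hb => simp [ha, hb]

/-! ### Fibres of the deformation complex and their complexifications -/

/-- The spinors `E₁ ⋯ Eₘ · Φ` span `prodSpan Φ m`. -/
def prodSpan (Φ : Spinor V) (m : ℕ) : Submodule ℝ (Spinor V) :=
  (LinearMap.range (CliffordAlgebra.ι (quad V)) ^ m).map ((spin V).toLinearMap.flip Φ)

theorem prodSpan_zero (Φ : Spinor V) : prodSpan Φ 0 = Submodule.span ℝ {Φ} := by
  rw [prodSpan, pow_zero, Submodule.one_eq_span, Submodule.map_span]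
  simp

theorem vecAction_mem_prodSpan {Φ φ : Spinor V} {m : ℕ} (E : V × Cov V) (h : φ ∈ prodSpan Φ m) :
    vecAction V E φ ∈ prodSpan Φ (m + 1) := by
  obtain ⟨a, ha, rfl⟩ := h
  refine ⟨CliffordAlgebra.ι (quad V) E * a, ?_, by simp⟩
  rw [pow_succ']
  exact Submodule.mul_mem_mul ⟨E, rfl⟩ ha

/-- Induction on the left-most factor of a product. -/
theorem prodSpan_succ_le {Φ : Spinor V} {m : ℕ} {W : Submodule ℝ (Spinor V)}
    (h : ∀ E, ∀ φ ∈ prodSpan Φ m, vecAction V E φ ∈ W) : prodSpan Φ (m + 1) ≤ W := by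
  rw [prodSpan, Submodule.map_le_iff_le_comap, pow_succ', Submodule.mul_le]
  rintro _ ⟨E, rfl⟩ a ha
  simpa using h E _ ⟨a, ha, rfl⟩

theorem defFibre_eq_iSup (Φ : Spinor V) (k : ℤ) :
    defFibre Φ k = ⨆ (m : ℕ) (_ : (m : ℤ) ≤ k + 1 ∧ Even (k + 1 - m)), prodSpan Φ m := by
  simp only [defFibre, CLfil, Submodule.map_iSup, prodSpan]

theorem prodSpan_le_defFibre {Φ : Spinor V} {k : ℤ} {m : ℕ} (h : (m : ℤ) ≤ k + 1)
    (he : Even (k + 1 - m)) : prodSpan Φ m ≤ defFibre Φ k := by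
  rw [defFibre_eq_iSup]
  exact le_iSup₂_of_le m ⟨h, he⟩ le_rfl

theorem defFibre_le {Φ : Spinor V} {k : ℤ} {W : Submodule ℝ (Spinor V)}
    (h : ∀ m : ℕ, (m : ℤ) ≤ k + 1 → Even (k + 1 - m) → prodSpan Φ m ≤ W) : defFibre Φ k ≤ W := by
  rw [defFibre_eq_iSup]
  exact iSup₂_le fun m hm => h m hm.1 hm.2

theorem defFibre_eq_bot {Φ : Spinor V} {k : ℤ} (hk : k < -1) : defFibre Φ k = ⊥ :=
  le_bot_iff.1 <| defFibre_le fun m hm _ => by omega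

theorem defFibre_neg_one (Φ : Spinor V) : defFibre Φ (-1) = Submodule.span ℝ {Φ} := by
  refine le_antisymm (defFibre_le fun m hm _ => ?_) ?_
  · obtain rfl : m = 0 := by omega
    exact (prodSpan_zero Φ).le
  · rw [← prodSpan_zero]
    exact prodSpan_le_defFibre (by simp) (by simp)

/-- The complex span of the fibre `E^k`. -/
def complexFibre (Φ : Spinor V) (k : ℤ) : Submodule ℂ (Spinor V) :=
  Submodule.span ℂ (defFibre Φ k)

theorem defFibre_le_complexFibre (Φ : Spinor V) (k : ℤ) :
    defFibre Φ k ≤ (complexFibre Φ k).restrictScalars ℝ :=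
  fun _ h => Submodule.subset_span h

/-- A complex linear operator maps complex fibres to one another if it does so for products. -/
theorem apply_mem_complexFibre {Φ : Spinor V} {k l : ℤ} {T : Module.End ℂ (Spinor V)}
    (h : ∀ m : ℕ, (m : ℤ) ≤ k + 1 → Even (k + 1 - m) → ∀ φ ∈ prodSpan Φ m,
      T φ ∈ complexFibre Φ l) {φ : Spinor V} (hφ : φ ∈ complexFibre Φ k) :
    T φ ∈ complexFibre Φ l := by
  suffices complexFibre Φ k ≤ (complexFibre Φ l).comap T from this hφ
  refine Submodule.span_le.2 ?_
  exact defFibre_le (W := ((complexFibre Φ l).comap T).restrictScalars ℝ) h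

/-- The Clifford action of `E`, as a complex linear operator. -/
def vecActionC (E : V × Cov V) : Module.End ℂ (Spinor V) where
  toFun := vecAction V E
  map_add' := map_add _
  map_smul' := vecAction_smul_complex E

@[simp] theorem vecActionC_apply (E : V × Cov V) (φ : Spinor V) :
    vecActionC E φ = vecAction V E φ := rfl

theorem vecAction_mem_complexFibre {Φ φ : Spinor V} {k : ℤ} (E : V × Cov V)
    (h : φ ∈ complexFibre Φ k) : vecAction V E φ ∈ complexFibre Φ (k + 1) :=
  apply_mem_complexFibre (T := vecActionC E) (fun m hm he _ hφ =>
    defFibre_le_complexFibre _ _ <| prodSpan_le_defFibre (m := m + 1) (by push_cast; omega)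
      (by push_cast; convert he using 1; ring) (vecAction_mem_prodSpan E hφ)) h

/-! ### Complex vectors annihilating `Φ` -/

/-- The action of the complex vector `F - i E`. -/
def complexVec (E F : V × Cov V) : Module.End ℂ (Spinor V) :=
  vecActionC F - Complex.I • vecActionC E

/-- The Clifford relation extended complex linearly in one argument. It serves twice: to lower the
filtration degree, and, with `G` a covector, as the homotopy identity. -/
theorem complexVec_anticomm (E F G : V × Cov V) (φ : Spinor V) :
    complexVec E F (vecAction V G φ) + vecAction V G (complexVec E F φ) =
      (((2 * pairing V F G : ℝ) : ℂ) - Complex.I * ((2 * pairing V E G : ℝ) : ℂ)) • φ := by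
  have hF := vecAction_anticomm F G φ
  have hE := vecAction_anticomm E G φ
  rw [← Complex.coe_smul (E := Spinor V)] at hE hF
  rw [sub_smul (M := Spinor V), mul_smul (β := Spinor V), ← hE, ← hF,
    smul_add (A := Spinor V)]
  simp only [complexVec, LinearMap.sub_apply, LinearMap.smul_apply, vecActionC_apply, map_sub,
    vecAction_smul_complex]
  abel

theorem complexVec_eq_zero {Φ φ : Spinor V} {E F : V × Cov V} (h : complexVec E F Φ = 0)
    (hφ : φ ∈ prodSpan Φ 0) : complexVec E F φ = 0 := by
  have : prodSpan Φ 0 ≤ (LinearMap.ker (complexVec E F)).restrictScalars ℝ := by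
    rw [prodSpan_zero, Submodule.span_singleton_le_iff_mem]
    exact h
  exact this hφ

/-- A complex vector annihilating `Φ` lowers the degree of products. -/
theorem complexVec_mem_span {Φ : Spinor V} {E F : V × Cov V} (h : complexVec E F Φ = 0) (m : ℕ) :
    ∀ φ ∈ prodSpan Φ (m + 1), complexVec E F φ ∈
      Submodule.span ℂ (prodSpan Φ m : Set (Spinor V)) := by
  -- Passing the leftmost factor `G` costs a scalar multiple of the remaining product and leaves `G`
  -- applied to a term controlled by induction.
  have key : ∀ (m : ℕ) (W : Submodule ℂ (Spinor V)), (prodSpan Φ m : Set (Spinor V)) ⊆ W →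
      (∀ G, ∀ φ ∈ prodSpan Φ m, vecAction V G (complexVec E F φ) ∈ W) →
      ∀ φ ∈ prodSpan Φ (m + 1), complexVec E F φ ∈ W := by
    intro m W hW hG
    refine prodSpan_succ_le (W := (W.comap (complexVec E F)).restrictScalars ℝ) fun G φ hφ => ?_
    change complexVec E F (vecAction V G φ) ∈ W
    rw [eq_sub_of_add_eq (complexVec_anticomm E F G φ)]
    exact W.sub_mem (W.smul_mem _ (hW hφ)) (hG G φ hφ)
  induction m with
  | zero =>
    refine key 0 _ Submodule.subset_span fun G φ hφ => ?_
    rw [complexVec_eq_zero h hφ, map_zero]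
    exact zero_mem _
  | succ m ih =>
    refine key (m + 1) _ Submodule.subset_span fun G φ hφ => ?_
    have : Submodule.span ℂ (prodSpan Φ m : Set (Spinor V)) ≤
        (Submodule.span ℂ (prodSpan Φ (m + 1) : Set (Spinor V))).comap (vecActionC G) :=
      Submodule.span_le.2 fun ψ hψ => Submodule.subset_span (vecAction_mem_prodSpan G hψ)
    exact this (ih φ hφ)

theorem complexVec_mem_complexFibre {Φ φ : Spinor V} {E F : V × Cov V}
    (h : complexVec E F Φ = 0) {k : ℤ} (hφ : φ ∈ complexFibre Φ k) :
    complexVec E F φ ∈ complexFibre Φ (k - 1) := by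
  refine apply_mem_complexFibre (fun m hm he φ hφ => ?_) hφ
  cases m with
  | zero =>
    rw [complexVec_eq_zero h hφ]
    exact zero_mem _
  | succ m =>
    refine Submodule.span_mono ?_ (complexVec_mem_span h m φ hφ)
    refine prodSpan_le_defFibre (by push_cast at hm; omega) ?_
    convert he using 1
    push_cast
    ring

/-! ### Exactness of the symbol sequences -/

/-- Multiplication by `i` on `(V ⊕ V^*) · Φ` is realised by a transformation of `V ⊕ V^*`. -/
def IsComplexOrbitPoint (Φ : Spinor V) : Prop :=
  ∀ E : V × Cov V, ∃ F : V × Cov V, Complex.I • vecAction V E Φ = vecAction V F Φ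

theorem exists_pairing_ne_zero {ξ : Cov V} (hξ : ξ ≠ 0) :
    ∃ v : V, pairing V (v, 0) (0, ξ) ≠ 0 := by
  obtain ⟨v, hv⟩ : ∃ v, ξ v ≠ 0 := by
    by_contra! h
    exact hξ (ContinuousLinearMap.ext h)
  exact ⟨v, by simpa [pairing] using hv⟩

/-- The symbol sequence of the complexified fibres is exact. -/
theorem exactAt_complexFibre {Φ : Spinor V} (hΦ : IsComplexOrbitPoint Φ) {ξ : Cov V} (hξ : ξ ≠ 0)
    (k : ℤ) : ExactAt (fun k => (complexFibre Φ k).restrictScalars ℝ) (wedge ξ) k := by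
  have hsq : ∀ φ, wedge ξ (wedge ξ φ) = 0 := fun φ => by
    rw [wedge_eq_vecAction, vecAction_vecAction, quad_apply, map_zero]
    exact zero_smul ℝ φ
  refine le_antisymm ?_ ?_
  · rintro _ ⟨φ, hφ, rfl⟩
    refine ⟨?_, hsq φ⟩
    have := vecAction_mem_complexFibre (0, ξ) hφ
    rwa [sub_add_cancel, ← wedge_eq_vecAction] at this
  · rintro φ ⟨hφ, h0⟩
    obtain ⟨v, hv⟩ := exists_pairing_ne_zero hξ
    obtain ⟨F, hF⟩ := hΦ (v, 0)
    have hu : complexVec (v, 0) F Φ = 0 := by simp [complexVec, hF]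
    -- Since `ξ ∧ φ = 0`, only one term of the anticommutator survives, exhibiting `c φ` as a wedge
    -- with `ξ`.
    have hc := complexVec_anticomm (v, 0) F (0, ξ) φ
    rw [← wedge_eq_vecAction, LinearMap.mem_ker.1 h0, map_zero, zero_add] at hc
    set c := ((2 * pairing V F (0, ξ) : ℝ) : ℂ) -
      Complex.I * ((2 * pairing V (v, 0) (0, ξ) : ℝ) : ℂ) with hcdef
    -- The pairings are real, so the imaginary part of `c` is `-2⟨v, ξ⟩`, whatever `F` is.
    have hc0 : c ≠ 0 := by
      intro h
      have := congrArg Complex.im h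
      simp [hcdef] at this
      exact hv this
    refine ⟨c⁻¹ • complexVec (v, 0) F φ,
      Submodule.smul_mem _ _ (complexVec_mem_complexFibre hu hφ), ?_⟩
    rw [wedge_eq_vecAction, vecAction_smul_complex, ← wedge_eq_vecAction, hc, inv_smul_smul₀ hc0]

/-- In degrees `k ≥ 0` the fibres are complex subspaces. -/
theorem complexFibre_eq_defFibre {Φ : Spinor V} (hΦ : IsComplexOrbitPoint Φ) {ξ : Cov V}
    (hξ : ξ ≠ 0) {k : ℤ} (hk : 0 ≤ k) :
    (complexFibre Φ k).restrictScalars ℝ = defFibre Φ k := by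
  -- The scalar `i` moves inward to the factor next to `Φ`, where it is absorbed; this needs at
  -- least one factor.
  have hI1 : ∀ m : ℕ, ∀ φ ∈ prodSpan Φ (m + 1), Complex.I • φ ∈ prodSpan Φ (m + 1) := by
    intro m
    induction m with
    | zero =>
      refine prodSpan_succ_le (W := (prodSpan Φ 1).comap
        ((Complex.I • (LinearMap.id : Module.End ℂ (Spinor V))).restrictScalars ℝ)) fun E φ hφ => ?_
      rw [prodSpan_zero] at hφ
      obtain ⟨c, rfl⟩ := Submodule.mem_span_singleton.1 hφ
      obtain ⟨F, hF⟩ := hΦ E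
      have : Complex.I • vecAction V E (c • Φ) = c • vecAction V F Φ := by
        rw [map_smul, smul_comm, hF]
      change Complex.I • vecAction V E (c • Φ) ∈ prodSpan Φ (0 + 1)
      rw [this]
      refine Submodule.smul_mem _ _ (vecAction_mem_prodSpan F ?_)
      rw [prodSpan_zero]
      exact Submodule.mem_span_singleton_self Φ
    | succ m ih =>
      refine prodSpan_succ_le (W := (prodSpan Φ (m + 2)).comap
        ((Complex.I • (LinearMap.id : Module.End ℂ (Spinor V))).restrictScalars ℝ)) fun E φ hφ => ?_
      change Complex.I • vecAction V E φ ∈ prodSpan Φ (m + 1 + 1)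
      rw [← vecAction_smul_complex]
      exact vecAction_mem_prodSpan E (ih φ hφ)
  -- With no factor to absorb `i`, one is created: `v ξ + ξ v` is a non-zero real scalar.
  have hI2 : Complex.I • Φ ∈ prodSpan Φ 2 := by
    obtain ⟨v, hv⟩ := exists_pairing_ne_zero hξ
    have hΦ0 : Φ ∈ prodSpan Φ 0 := by
      rw [prodSpan_zero]; exact Submodule.mem_span_singleton_self Φ
    have hmem : ∀ E F, Complex.I • vecAction V E (vecAction V F Φ) ∈ prodSpan Φ 2 := fun E F =>
      hI1 1 _ (vecAction_mem_prodSpan E (vecAction_mem_prodSpan F hΦ0))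
    have h := (prodSpan Φ 2).add_mem (hmem (v, 0) (0, ξ)) (hmem (0, ξ) (v, 0))
    rw [← smul_add (A := Spinor V), vecAction_anticomm, smul_comm] at h
    exact (Submodule.smul_mem_iff _ (mul_ne_zero two_ne_zero hv)).1 h
  have hI : ∀ φ ∈ defFibre Φ k, Complex.I • φ ∈ defFibre Φ k := by
    refine defFibre_le (W := (defFibre Φ k).comap
        ((Complex.I • (LinearMap.id : Module.End ℂ (Spinor V))).restrictScalars ℝ))
        fun m hm he φ hφ => ?_
    change Complex.I • φ ∈ defFibre Φ k
    cases m with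
    | zero =>
      rw [prodSpan_zero] at hφ
      obtain ⟨c, rfl⟩ := Submodule.mem_span_singleton.1 hφ
      rw [smul_comm]
      -- Here `k + 1` is even and positive, hence at least `2`, so products of two vectors belong to
      -- the filtration.
      obtain ⟨r, hr⟩ := he
      refine Submodule.smul_mem _ _ (prodSpan_le_defFibre (m := 2) ?_ ⟨r - 1, ?_⟩ hI2)
      · push_cast at hr ⊢; omega
      · push_cast at hr ⊢; omega
    | succ m => exact prodSpan_le_defFibre hm he (hI1 m φ hφ)
  refine le_antisymm ?_ (defFibre_le_complexFibre Φ k)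
  intro φ hφ
  refine Submodule.span_induction (fun _ h => h) (zero_mem _) (fun _ _ _ _ => add_mem) ?_ hφ
  intro c ψ _ hψ
  have : c • ψ = c.re • ψ + c.im • (Complex.I • ψ) := by
    conv_lhs => rw [← Complex.re_add_im c]
    rw [add_smul (M := Spinor V), mul_smul (β := Spinor V), 
      Complex.coe_smul (E := Spinor V), Complex.coe_smul (E := Spinor V)]
  rw [this]
  exact add_mem (Submodule.smul_mem _ _ hψ) (Submodule.smul_mem _ _ (hI ψ hψ))

theorem complexFibre_eq_bot {Φ : Spinor V} {k : ℤ} (hk : k < -1) : complexFibre Φ k = ⊥ := by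
  simp [complexFibre, defFibre_eq_bot hk]

theorem complexFibre_neg_one (Φ : Spinor V) : complexFibre Φ (-1) = Submodule.span ℂ {Φ} := by
  rw [complexFibre, defFibre_neg_one, Submodule.span_span_of_tower]

theorem defFibreC_eq_complexFibre {Φ : Spinor V} (hΦ : IsComplexOrbitPoint Φ) {ξ : Cov V}
    (hξ : ξ ≠ 0) (k : ℤ) : defFibreC Φ k = (complexFibre Φ k).restrictScalars ℝ := by
  rcases lt_trichotomy k (-1) with hk | rfl | hk
  · rw [defFibreC, if_neg hk.ne, defFibre_eq_bot hk, complexFibre_eq_bot hk]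
    rfl
  · rw [defFibreC, if_pos rfl, complexFibre_neg_one]
  · rw [defFibreC, if_neg hk.ne', complexFibre_eq_defFibre hΦ hξ (by omega)]

theorem exactAt_defFibreC {Φ : Spinor V} (hΦ : IsComplexOrbitPoint Φ) {ξ : Cov V} (hξ : ξ ≠ 0)
    (k : ℤ) : ExactAt (defFibreC Φ) (wedge ξ) k := by
  rw [funext (defFibreC_eq_complexFibre hΦ hξ)]
  exact exactAt_complexFibre hΦ hξ k

/-- The term of degree `-1` enters exactness only at degrees `-1` and `0`. At `-1` exactness means
injectivity, which passes from `ℂΦ` to `ℝΦ`. At `0` it fails when `Φ ≠ 0`: `i ξ ∧ Φ` is in the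
kernel but is not a real multiple of `ξ ∧ Φ`. -/
theorem exactAt_defFibre {Φ : Spinor V} (hΦ : IsComplexOrbitPoint Φ) {ξ : Cov V} (hξ : ξ ≠ 0)
    {k : ℤ} (hk : k ≠ 0) : ExactAt (defFibre Φ) (wedge ξ) k := by
  have hC := exactAt_defFibreC hΦ hξ k
  rw [ExactAt, defFibreC, if_neg (by omega : k - 1 ≠ -1)] at hC
  by_cases hk1 : k = -1
  · subst hk1
    rw [defFibre_eq_bot (by norm_num), Submodule.map_bot] at hC
    rw [ExactAt, defFibre_eq_bot (by norm_num), Submodule.map_bot]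
    refine (le_bot_iff.1 ?_).symm
    rw [hC, defFibreC_eq_complexFibre hΦ hξ]
    exact inf_le_inf_right _ (defFibre_le_complexFibre Φ (-1))
  · rwa [defFibreC, if_neg hk1] at hC

/-! ### Points of the orbit absorb multiplication by `i` -/

/-- An alternating form of degree greater than the complex dimension that is complex linear in
each argument vanishes. -/
theorem eq_zero_of_complex_linear [FiniteDimensional ℝ V] {n : ℕ}
    (hV : Module.finrank ℝ V = 2 * n) (J : V →ₗ[ℝ] V) (β : V [⋀^Fin (n + 1)]→L[ℝ] ℂ)
    (hβ : ∀ u i, β (Function.update u i (J (u i))) = Complex.I * β u) : β = 0 := by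
  ext u
  -- These are `2n + 2` vectors in real dimension `2n`.
  have hdep : ¬ LinearIndependent ℝ (Sum.elim u (fun i => J (u i))) := fun h => by
    have := h.fintype_card_le_finrank
    simp [hV] at this
    omega
  rw [Fintype.not_linearIndependent_iff] at hdep
  obtain ⟨g, hg, s, hs⟩ := hdep
  obtain ⟨j, hj⟩ : ∃ j, g (.inl j) ≠ 0 ∨ g (.inr j) ≠ 0 := by
    rcases s with j | j
    exacts [⟨j, .inl hs⟩, ⟨j, .inr hs⟩]
  rw [Fintype.sum_sum_type] at hg
  simp only [Sum.elim_inl, Sum.elim_inr] at hg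
  have hJ : ∀ x, β (Function.update u j (J x)) = Complex.I * β (Function.update u j x) := by
    intro x
    simpa using hβ (Function.update u j x) j
  have hne : ∀ i, i ≠ j → β (Function.update u j (u i)) = 0 := fun i hi =>
    β.map_eq_zero_of_eq _ (i := i) (j := j) (by simp [hi]) hi
  let T : V →ₗ[ℝ] ℂ := β.toMultilinearMap.toLinearMap u j
  have hT : ∀ x, T x = β (Function.update u j x) := fun _ => rfl
  -- Inserted in slot `j`, the relation keeps only its `u j` and `J (u j)` terms: for `i ≠ j` an
  -- argument is repeated, after `J` is pulled out as `i`.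
  have h0 := congrArg T hg
  rw [map_add, map_sum, map_sum, map_zero, Finset.sum_eq_single j, Finset.sum_eq_single j] at h0
  · rw [map_smul, map_smul, hT, hT, hJ, Function.update_eq_self, Complex.real_smul,
      Complex.real_smul] at h0
    have h1 : ((g (.inl j) : ℂ) + g (.inr j) * Complex.I) * β u = 0 := by
      rw [← h0]; ring
    rcases mul_eq_zero.1 h1 with h | h
    · have hre := congrArg Complex.re h
      have him := congrArg Complex.im h
      simp at hre him
      rcases hj with h | h <;> contradiction
    · simpa using h
  · intro i _ hi
    rw [map_smul, hT, hJ, hne i hi, mul_zero, smul_zero]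
  · simp
  · intro i _ hi
    rw [map_smul, hT, hne i hi, smul_zero]
  · simp

/-- The covector `η ∘ J + i η` is of type `(1,0)`, so its wedge with `α` would be of type `(n+1,0)`.
-/
theorem wedgeForm_comp_complex_structure [FiniteDimensional ℝ V] {n : ℕ}
    (hV : Module.finrank ℝ V = 2 * n) (J : V →ₗ[ℝ] V) (hJ : ∀ v, J (J v) = -v)
    (α : V [⋀^Fin n]→L[ℝ] ℂ)
    (hα : ∀ u i, α (Function.update u i (J (u i))) = Complex.I * α u) (η : Cov V) :
    wedgeForm (η.comp J.toContinuousLinearMap) α + Complex.I • wedgeForm η α = 0 := by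
  refine eq_zero_of_complex_linear hV J _ fun u i => ?_
  simp only [ContinuousAlternatingMap.add_apply, ContinuousAlternatingMap.smul_apply,
    wedgeForm_apply, Finset.smul_sum, ← Finset.sum_add_distrib, Finset.mul_sum]
  refine Finset.sum_congr rfl fun j _ => ?_
  by_cases hij : i = j
  · subst hij
    simp only [Function.update_self, Fin.removeNth_update, ContinuousLinearMap.comp_apply,
      LinearMap.coe_toContinuousLinearMap', hJ, map_neg, zsmul_eq_mul, smul_eq_mul,
      Complex.real_smul, Complex.ofReal_neg]
    linear_combination (((-1 : ℤ) ^ (i : ℕ) : ℤ) : ℂ) * (-(η (u i) : ℂ)) *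
      α (i.removeNth u) * Complex.I_mul_I
  · obtain ⟨i', rfl⟩ := Fin.exists_succAbove_eq hij
    have h : α (j.removeNth (Function.update u (j.succAbove i') (J (u (j.succAbove i'))))) =
        Complex.I * α (j.removeNth u) := by
      rw [← hα (j.removeNth u) i', Fin.removeNth_update_succAbove]
      rfl
    rw [h, Function.update_of_ne (Ne.symm hij)]
    simp only [zsmul_eq_mul, smul_eq_mul, Complex.real_smul]
    ring

/-- The vector and covector parts separate: `i` acts as `J` on contracted vectors and as `-J^*` on
wedged covectors. -/
theorem isComplexOrbitPoint_of_mem_ASL [FiniteDimensional ℝ V] {n : ℕ}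
    (hV : Module.finrank ℝ V = 2 * n) {Ω : Spinor V} (h : Ω ∈ ASL V n) :
    IsComplexOrbitPoint Ω := by
  obtain ⟨J, α, hJ, -, hα, rfl⟩ := h
  rintro ⟨v, η⟩
  refine ⟨(J v, -(η.comp J.toContinuousLinearMap)), ?_⟩
  rw [vecAction_apply, vecAction_apply, smul_add]
  congr 1
  · funext p
    ext u
    by_cases hp : p + 1 = n
    · subst hp
      have := hα (Matrix.vecCons v u) 0
      simpa [Matrix.vecCons] using this.symm
    · simp [Pi.single_eq_of_ne hp]
  · funext p
    cases p with
    | zero => simp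
    | succ q =>
      ext u
      by_cases hq : q = n
      · subst hq
        have := congrArg (fun β => β u) (wedgeForm_comp_complex_structure hV J hJ α hα η)
        simp only [ContinuousAlternatingMap.add_apply, ContinuousAlternatingMap.smul_apply] at this
        rw [Pi.smul_apply, wedge_succ, wedge_succ, Pi.single_eq_same,
          ContinuousAlternatingMap.smul_apply, eq_neg_of_add_eq_zero_right this]
        simp [wedgeForm_apply]
      · simp [wedgeForm_apply, Pi.single_eq_of_ne hq]

/-- With `T a = g̃⁻¹ a g` one has `E g = g̃ T(E)`. The map `T` is injective on the
finite-dimensional space `V ⊕ V^*`, hence bijective there, so the vector found for `T(E)` at `Ω` can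
be pulled back through `T`. -/
theorem isComplexOrbitPoint_spin [FiniteDimensional ℝ V] {Ω : Spinor V}
    (h : IsComplexOrbitPoint Ω) {g : (CL V)ˣ} (hg : g ∈ Cpin V) :
    IsComplexOrbitPoint (spin V (g : CL V) Ω) := by
  let gt : (CL V)ˣ := Units.map (CliffordAlgebra.involute (Q := quad V)).toMonoidHom g
  have hgt : CliffordAlgebra.involute ((g⁻¹ : (CL V)ˣ) : CL V) = ((gt⁻¹ : (CL V)ˣ) : CL V) := rfl
  let R := LinearMap.range (CliffordAlgebra.ι (quad V))
  let T : CL V →ₗ[ℝ] CL V :=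
    LinearMap.mulRight ℝ (g : CL V) ∘ₗ LinearMap.mulLeft ℝ ((gt⁻¹ : (CL V)ˣ) : CL V)
  have hT : ∀ a, T a = ((gt⁻¹ : (CL V)ˣ) : CL V) * a * g := fun _ => rfl
  have hTR : ∀ a ∈ R, T a ∈ R := by
    rintro _ ⟨E, rfl⟩
    have := hg E
    rwa [hgt] at this
  have hinj : Function.Injective (T.restrict hTR) := by
    rintro ⟨a, ha⟩ ⟨b, hb⟩ hab
    have := congrArg Subtype.val hab
    simpa [hT] using this
  have hsurj := LinearMap.injective_iff_surjective.1 hinj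
  have hmul : ∀ a, a * (g : CL V) = gt * T a := fun a => by
    rw [hT, mul_assoc, Units.mul_inv_cancel_left]
  intro E
  obtain ⟨E₁, hE₁⟩ := hTR (CliffordAlgebra.ι (quad V) E) ⟨E, rfl⟩
  obtain ⟨F₁, hF₁⟩ := h E₁
  obtain ⟨⟨_, F, rfl⟩, hF⟩ := hsurj ⟨CliffordAlgebra.ι (quad V) F₁, F₁, rfl⟩
  have hF' : T (CliffordAlgebra.ι (quad V) F) = CliffordAlgebra.ι (quad V) F₁ :=
    congrArg Subtype.val hF
  refine ⟨F, ?_⟩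
  rw [← spin_ι, ← spin_ι, ← Module.End.mul_apply, ← Module.End.mul_apply, ← map_mul, ← map_mul,
    hmul, hmul, ← hE₁, hF', map_mul, map_mul, Module.End.mul_apply, Module.End.mul_apply,
    ← spin_smul_complex, spin_ι, spin_ι, hF₁]

theorem isComplexOrbitPoint_of_mem_BSL [FiniteDimensional ℝ V] {n : ℕ}
    (hV : Module.finrank ℝ V = 2 * n) {Φ : Spinor V} (h : Φ ∈ BSL V n) :
    IsComplexOrbitPoint Φ := by
  obtain ⟨Ω, hΩ, g, hg, rfl⟩ := h
  exact isComplexOrbitPoint_spin (isComplexOrbitPoint_of_mem_ASL hV hΩ) hg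

end Linear

/-! ### The principal symbol of the exterior derivative -/

section Manifold

variable {V : Type*} [NormedAddCommGroup V] [NormedSpace ℝ V]
variable {X : Type*} [TopologicalSpace X] [ChartedSpace V X]

/-- Leibniz rule, with the term `g dβ` killed by the vanishing of `g` at `y`. -/
theorem extDeriv_smul_of_eq_zero {p : ℕ} {g : V → ℝ} {β : V → V [⋀^Fin p]→L[ℝ] ℂ} {y : V}
    (hg : DifferentiableAt ℝ g y) (hβ : DifferentiableAt ℝ β y) (h0 : g y = 0) :
    extDeriv (fun z => g z • β z) y = wedgeForm (fderiv ℝ g y) (β y) := by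
  rw [extDeriv, fderiv_fun_smul hg hβ, h0, zero_smul, zero_add, wedgeForm]

theorem wedgeForm_compContinuousLinearMap {p : ℕ} (η : Cov V) (α : V [⋀^Fin p]→L[ℝ] ℂ)
    (A : V →L[ℝ] V) : (wedgeForm η α).compContinuousLinearMap A =
      wedgeForm (η.comp A) (α.compContinuousLinearMap A) := by
  ext u
  simp only [ContinuousAlternatingMap.compContinuousLinearMap_apply, wedgeForm_apply,
    Function.comp_apply, ContinuousLinearMap.comp_apply]
  rfl

/-- Used with `A` and `B` the derivatives of the inverse chart and of the chart: the two pull-backs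
in `dForm` cancel. -/
theorem wedgeForm_compContinuousLinearMap_of_comp_eq_id {p : ℕ} (η : Cov V)
    (α : V [⋀^Fin p]→L[ℝ] ℂ) {A B : V →L[ℝ] V} (hAB : A.comp B = ContinuousLinearMap.id ℝ V) :
    (wedgeForm (η.comp A) (α.compContinuousLinearMap A)).compContinuousLinearMap B =
      wedgeForm η α := by
  have hv : ∀ v, A (B v) = v := fun v => congrArg (fun T : V →L[ℝ] V => T v) hAB
  rw [wedgeForm_compContinuousLinearMap, ContinuousLinearMap.comp_assoc, hAB,
    ContinuousLinearMap.comp_id]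
  congr 1
  ext u
  simp [Function.comp_def, hv]

/-- The principal symbol of the exterior derivative is the exterior product. -/
theorem isPrincipalSymbol_dForm [IsManifold 𝓘(ℝ, V) ∞ X] (x : X) (ξ : Cov V) :
    IsPrincipalSymbol dForm x ξ (wedge ξ) := by
  intro f α hf hα hfx hdf
  have : IsManifold 𝓘(ℝ, V) 1 X := .of_le (n := ∞) (by simp)
  funext p
  cases p with
  | zero => rfl
  | succ p =>
    set e := extChartAt 𝓘(ℝ, V) x
    have hx : x ∈ e.source := mem_extChartAt_source x
    have hsymm : e.symm (e x) = x := e.left_inv hx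
    have hB : MDifferentiableAt 𝓘(ℝ, V) 𝓘(ℝ, V) e.symm (e x) := by
      have := mdifferentiableWithinAt_extChartAt_symm (I := 𝓘(ℝ, V)) (e.map_source hx)
      rwa [modelWithCornersSelf_coe, Set.range_id, mdifferentiableWithinAt_univ] at this
    have hfd : MDifferentiableAt 𝓘(ℝ, V) 𝓘(ℝ, ℝ) f (e.symm (e x)) :=
      hf.mdifferentiableAt (by simp)
    have hβ : DifferentiableAt ℝ (inChart α x p) (e x) :=
      ((hα x p).contDiffAt (extChartAt_target_mem_nhds x)).differentiableAt (by simp)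
    have hinv : (mfderiv 𝓘(ℝ, V) 𝓘(ℝ, V) e.symm (e x) : V →L[ℝ] V).comp
        (mfderiv 𝓘(ℝ, V) 𝓘(ℝ, V) e x : V →L[ℝ] V) = ContinuousLinearMap.id ℝ V := by
      have := mfderivWithin_extChartAt_symm_comp_mfderiv_extChartAt' (I := 𝓘(ℝ, V)) hx
      rw [modelWithCornersSelf_coe, Set.range_id, mfderivWithin_univ] at this
      exact this
    have hg : DifferentiableAt ℝ (f ∘ e.symm) (e x) := (hfd.comp (e x) hB).differentiableAt
    have hdg : fderiv ℝ (f ∘ e.symm) (e x) =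
        ξ.comp (mfderiv 𝓘(ℝ, V) 𝓘(ℝ, V) e.symm (e x) : V →L[ℝ] V) := by
      rw [← mfderiv_eq_fderiv, mfderiv_comp _ hfd hB, ← hdf, hsymm]
      rfl
    have hmain := extDeriv_smul_of_eq_zero hg hβ (by simp [hsymm, hfx])
    let A : V →L[ℝ] V := mfderiv 𝓘(ℝ, V) 𝓘(ℝ, V) e.symm (e x)
    let B : V →L[ℝ] V := mfderiv 𝓘(ℝ, V) 𝓘(ℝ, V) e x
    have hval : inChart α x p (e x) = (α x p).compContinuousLinearMap A :=
      congrArg (fun z => (α z p).compContinuousLinearMap A) hsymm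
    rw [hdg, hval] at hmain
    exact (congrArg (fun γ => γ.compContinuousLinearMap B) hmain).trans
      (wedgeForm_compContinuousLinearMap_of_comp_eq_id ξ (α x p) hinv)

end Manifold

end GenSL

end

open GenSL in
theorem mainTheorem7 (n : ℕ) (V : Type*) [NormedAddCommGroup V] [NormedSpace ℝ V]
    [FiniteDimensional ℝ V] (hV : Module.finrank ℝ V = 2 * n) :
    IsEllipticOrbit (BSL V n) ∧
    ∀ (X : Type*) [TopologicalSpace X] [T2Space X] [ChartedSpace V X]
      [IsManifold 𝓘(ℝ, V) ∞ X] (ϕ : X → Spinor V), IsStructure (BSL V n) ϕ →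
      (∀ k : ℤ, k ≠ 0 → IsEllipticAt (fun x => defFibre (ϕ x)) dForm k) ∧
      (∀ k : ℤ, IsEllipticAt (fun x => defFibreC (ϕ x)) dForm k) := by
  refine ⟨fun Φ hΦ ξ hξ k hk => exactAt_defFibre (isComplexOrbitPoint_of_mem_BSL hV hΦ) hξ
    (by omega), fun X _ _ _ _ ϕ hϕ => ⟨fun k hk x ξ hξ => ?_, fun k x ξ hξ => ?_⟩⟩
  · exact ⟨wedge ξ, isPrincipalSymbol_dForm x ξ,
      exactAt_defFibre (isComplexOrbitPoint_of_mem_BSL hV (hϕ.mem_orbit x)) hξ hk⟩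
  · exact ⟨wedge ξ, isPrincipalSymbol_dForm x ξ,
      exactAt_defFibreC (isComplexOrbitPoint_of_mem_BSL hV (hϕ.mem_orbit x)) hξ k⟩
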